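/- Let $d, k$ be integers with $2 \le k \le \lfloor d/2 \rfloor$. Let $\lambda(d,k)$ be the smallest number $n$ such that every set $X$ of $n$ points in $\mathbb{R}^d$ can be divided into two disjoint sets $A$ and $B$ with $A \cup B = X$ and $$\operatorname{conv}(A\setminus K)\,\cap\,\operatorname{conv}(B\setminus K)\neq\emptyset \quad\text{for every } K \subseteq X \text{ with at most } k \text{ elements}$$ (for $|X| \ge k$ this is the same as asking it for every $K \subseteq X$ with exactly $k$ elements). Then $\lambda(d,k)$ exists and $$2d + k + 1 \;\le\; \lambda(d,k) \;\le\; (k+1)d + (k+2).$$ -/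

import Mathlib

/-- A finite set `X` of points of `ℝ^d` is `k`-divisible if it is the disjoint union of two sets
`A`, `B` such that `conv (A \ K)` and `conv (B \ K)` intersect for every set
`K = {x₁, …, x_k} ⊆ X`, repetitions among the `xᵢ` allowed; that is, for every `K ⊆ X` with at
most `k` elements. -/
def IsDivisible {d : ℕ} (k : ℕ) (X : Finset (EuclideanSpace ℝ (Fin d))) : Prop :=
  ∃ A B : Set (EuclideanSpace ℝ (Fin d)),
    A ∪ B = (X : Set (EuclideanSpace ℝ (Fin d))) ∧ A ∩ B = ∅ ∧
    ∀ K : Finset (EuclideanSpace ℝ (Fin d)), K ⊆ X → K.card ≤ k →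
      (convexHull ℝ (A \ (K : Set (EuclideanSpace ℝ (Fin d)))) ∩
        convexHull ℝ (B \ (K : Set (EuclideanSpace ℝ (Fin d))))).Nonempty

/-- As soon as `X` has `k` points at all, it is the same to remove exactly `k` points. (With fewer
than `k` points there would be nothing to remove, and the condition would be void.) -/
theorem isDivisible_iff_card_eq {d k : ℕ} {X : Finset (EuclideanSpace ℝ (Fin d))}
    (hX : k ≤ X.card) :
    IsDivisible k X ↔
      ∃ A B : Set (EuclideanSpace ℝ (Fin d)),
        A ∪ B = (X : Set (EuclideanSpace ℝ (Fin d))) ∧ A ∩ B = ∅ ∧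
        ∀ K : Finset (EuclideanSpace ℝ (Fin d)), K ⊆ X → K.card = k →
          (convexHull ℝ (A \ (K : Set (EuclideanSpace ℝ (Fin d)))) ∩
            convexHull ℝ (B \ (K : Set (EuclideanSpace ℝ (Fin d))))).Nonempty := by
  constructor
  · rintro ⟨A, B, h1, h2, h3⟩
    exact ⟨A, B, h1, h2, fun K hK hc => h3 K hK hc.le⟩
  · rintro ⟨A, B, h1, h2, h3⟩
    refine ⟨A, B, h1, h2, fun K hK hc => ?_⟩
    obtain ⟨L, hKL, hLX, hL⟩ := Finset.exists_subsuperset_card_eq hK hc hX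
    have hs : (K : Set (EuclideanSpace ℝ (Fin d))) ⊆ L := Finset.coe_subset.2 hKL
    exact (h3 L hLX hL).mono (Set.inter_subset_inter
      (convexHull_mono (Set.sdiff_subset_sdiff_right hs))
      (convexHull_mono (Set.sdiff_subset_sdiff_right hs)))

/-- The numbers `n` such that every set of `n` points of `ℝ^d` is `k`-divisible. -/
def divisibleCards (d k : ℕ) : Set ℕ :=
  {n | ∀ X : Finset (EuclideanSpace ℝ (Fin d)), X.card = n → IsDivisible k X}

/-- `λ(d, k)`: the smallest number `n` such that every set of `n` points of `ℝ^d` is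
`k`-divisible. -/
noncomputable def divisibilityNumber (d k : ℕ) : ℕ := sInf (divisibleCards d k)

/-!
The upper bound is Radon's theorem with tolerance. Lift a point `x` to `(x, 1)`, in dimension
`m = d + 1`. A partition is `k`-divisible as soon as its signs keep the origin in the convex hull of
the signed vectors after the removal of any `k` of them. Among `(k + 1) * m + 1` vectors such signs
exist (`exists_tolerant_signs`): choose them so that the largest distance from the origin to the
hull of what remains after a removal is minimal. If it is positive, attained at `p`, then at most
`m` vectors `F` carry `p`, by Carathéodory's theorem on the supporting hyperplane. The vectors
outside `F` are at least `k * m + 1`, so they have, by induction, signs that tolerate the removal of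
`k - 1` of them; up to a global sign, more than `k` of them have a nonpositive inner product with
`p`. With these new signs every distance drops: if a removal meets `F`, the origin is in the hull;
if it does not, then `p` and a vector pointing away from `p` remain.

For the lower bound, take vectors `(a i j * B ^ (2 * i * j))_i` with signs `a` and `B` large. Linear
functionals realize on them every sign pattern that follows `a`, up to one sign for each row, along
a staircase `j ↦ p j` of rows (`exists_coeff_of_monotone`). The matrix `diagonalSign` is such that
the greedy staircase, measured from the diagonal, is a walk on `ℤ` that reacts to the changes of sign
in opposite ways on the two sides of the diagonal. A walk that ends on the wrong side can be replaced
by a reflected one on the right side, at the cost of two changes of sign (`reaches_invariant`). So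
`m` rows handle `2 * m` columns with two errors, and each additional row handles three columns with
one error (`exists_staircase`). With `d + 1` rows, this makes `2 * d + k` points for which every
partition is separated by a hyperplane after the removal of `k` points.
-/

/-! ### Radon's theorem with tolerance -/

/-- The nearest point `p` of a convex set to the origin supports the set. -/
theorem norm_sq_le_inner_of_infDist_eq {E : Type*} [NormedAddCommGroup E] [InnerProductSpace ℝ E]
    {C : Set E} (hC : Convex ℝ C) {p : E} (hp : p ∈ C) (h : Metric.infDist 0 C = ‖p‖)
    {y : E} (hy : y ∈ C) : ‖p‖ ^ 2 ≤ inner ℝ p y := by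
  have h1 : ‖(0 : E) - p‖ = ⨅ w : C, ‖(0 : E) - w‖ := by
    rw [Metric.infDist_eq_iInf] at h
    simpa [dist_eq_norm] using h.symm
  have h2 := (norm_eq_iInf_iff_real_inner_le_zero hC hp).1 h1 y hy
  rw [zero_sub, inner_neg_left, inner_sub_right, real_inner_self_eq_norm_sq] at h2
  linarith

/-- Carathéodory's theorem on the supporting hyperplane at the nearest point to the origin saves
one point: `finrank ℝ E` points suffice. -/
theorem exists_card_le_finrank_of_supporting {E : Type*} [NormedAddCommGroup E]
    [InnerProductSpace ℝ E] [FiniteDimensional ℝ E] {C : Set E} {p : E} (hp0 : p ≠ 0)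
    (hp : p ∈ convexHull ℝ C) (hC : ∀ x ∈ C, ‖p‖ ^ 2 ≤ inner ℝ p x) :
    ∃ F : Finset E, (F : Set E) ⊆ C ∧ F.card ≤ Module.finrank ℝ E ∧
      p ∈ convexHull ℝ (F : Set E) := by
  classical
  obtain ⟨ι, _, z, w, hz, hind, hw, hw1, hwp⟩ := eq_pos_convex_span_of_mem_convexHull hp
  have hle : ∀ i, ‖p‖ ^ 2 ≤ inner ℝ p (z i) := fun i => hC _ (hz ⟨i, rfl⟩)
  have hsum : ∑ i, w i * (inner ℝ p (z i) - ‖p‖ ^ 2) = 0 := by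
    have : ∑ i, w i * inner ℝ p (z i) = ‖p‖ ^ 2 := by
      calc ∑ i, w i * inner ℝ p (z i) = inner ℝ p (∑ i, w i • z i) := by
            simp only [inner_sum, inner_smul_right]
        _ = ‖p‖ ^ 2 := by rw [hwp, real_inner_self_eq_norm_sq]
    simp only [mul_sub, Finset.sum_sub_distrib, this, ← Finset.sum_mul, hw1, one_mul, sub_self]
  have heq : ∀ i, inner ℝ p (z i) = ‖p‖ ^ 2 := by
    intro i
    have := (Finset.sum_eq_zero_iff_of_nonneg
      (fun i _ => mul_nonneg (hw i).le (sub_nonneg.2 (hle i)))).1 hsum i (Finset.mem_univ i)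
    rcases mul_eq_zero.1 this with h | h
    · exact absurd h (hw i).ne'
    · linarith
  have hcard : Fintype.card ι ≤ Module.finrank ℝ E := by
    by_contra hlt
    have h1 : Fintype.card ι = Module.finrank ℝ E + 1 :=
      le_antisymm (hind.card_le_finrank_succ.trans
        (Nat.succ_le_succ (Submodule.finrank_le _))) (by omega)
    have h2 := hind.affineSpan_eq_top_iff_card_eq_finrank_add_one.2 h1
    -- the affine span of the points lies on the supporting hyperplane, which misses the origin
    have h3 : affineSpan ℝ (Set.range z) ≤
        AffineSubspace.mk' p (LinearMap.ker (innerₛₗ ℝ p)) := by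
      rw [affineSpan_le]
      rintro _ ⟨i, rfl⟩
      simp [AffineSubspace.mem_mk', inner_sub_right, heq i]
    rw [h2] at h3
    have h4 : (0 : E) ∈ AffineSubspace.mk' p (LinearMap.ker (innerₛₗ ℝ p)) :=
      h3 (AffineSubspace.mem_top ℝ E 0)
    simp [AffineSubspace.mem_mk', hp0] at h4
  refine ⟨Finset.univ.image z, by simpa using hz, Finset.card_image_le.trans hcard, ?_⟩
  rw [← hwp]
  exact (convex_convexHull ℝ _).sum_mem (fun i _ => (hw i).le) hw1
    (fun i _ => subset_convexHull ℝ _ (by simp))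

/-- Signs with tolerance: among `j * dim E + 1` vectors of a space of dimension at least two, signs
can be chosen so that the origin stays in the convex hull of the signed vectors whenever fewer
than `j` of them are removed. By induction on `j`, applied to the vectors outside a set that carries the
nearest point to the origin of the worst hull. -/
theorem exists_tolerant_signs {E : Type*} [NormedAddCommGroup E]
    [InnerProductSpace ℝ E] [FiniteDimensional ℝ E] (hE : 2 ≤ Module.finrank ℝ E)
    {ι : Type*} [Fintype ι] [DecidableEq ι] (v : ι → E) (j : ℕ) :
    ∀ S : Finset ι, j * Module.finrank ℝ E + 1 ≤ S.card →
      ∃ s : ι → ℤˣ, ∀ K : Finset ι, K.card < j →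
        (0 : E) ∈ convexHull ℝ ((fun i => ((s i : ℤ) : ℝ) • v i) '' ((S \ K : Finset ι) : Set ι)) := by
  induction j with
  | zero => exact fun S _ => ⟨fun _ => 1, fun K hK => absurd hK (Nat.not_lt_zero _)⟩
  | succ j ih =>
  intro S hS
  set m := Module.finrank ℝ E with hm
  set y : (ι → ℤˣ) → ι → E := fun s i => ((s i : ℤ) : ℝ) • v i with hy
  let C : (ι → ℤˣ) → Finset ι → Set E :=
    fun s K => convexHull ℝ (y s '' ((S \ K : Finset ι) : Set ι))
  let P : Finset (Finset ι) := Finset.univ.filter fun K => K.card < j + 1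
  have hP : P.Nonempty := ⟨∅, by simp [P]⟩
  have hjm : j + 1 ≤ (j + 1) * m := Nat.le_mul_of_pos_right _ (by omega)
  have hne : ∀ K : Finset ι, K.card < j + 1 → (S \ K).Nonempty := by
    intro K hK
    rw [← Finset.card_pos]
    have := Finset.le_card_sdiff K S
    omega
  have hCne : ∀ s, ∀ K : Finset ι, K.card < j + 1 → (C s K).Nonempty := fun s K hK =>
    (((hne K hK).to_set).image _).convexHull
  have hCcpt : ∀ s K, IsCompact (C s K) := fun s K =>
    ((Finset.finite_toSet _).image _).isCompact_convexHull ℝ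
  -- signs for which the largest of the distances from the origin is smallest
  obtain ⟨s, hs⟩ := Finite.exists_min fun s => P.sup' hP fun K => Metric.infDist 0 (C s K)
  refine ⟨s, ?_⟩
  obtain ⟨K₀, hK₀P, hK₀⟩ := P.exists_mem_eq_sup' hP fun K => Metric.infDist 0 (C s K)
  have hK₀j : K₀.card < j + 1 := by simpa [P] using hK₀P
  obtain ⟨p, hpC, hp⟩ := (hCcpt s K₀).exists_infDist_eq_dist (hCne s K₀ hK₀j) 0
  rw [dist_zero_left] at hp
  by_cases hp0 : p = 0
  · intro K hK
    have h1 : Metric.infDist 0 (C s K) ≤ 0 := by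
      have := Finset.le_sup' (fun K => Metric.infDist 0 (C s K))
        (show K ∈ P by simpa [P] using hK)
      rw [hK₀, hp, hp0, norm_zero] at this
      exact this
    exact ((hCcpt s K).isClosed.mem_iff_infDist_zero (hCne s K hK)).2
      (le_antisymm h1 Metric.infDist_nonneg)
  exfalso
  obtain ⟨F', hF'C, hF'm, hpF'⟩ := exists_card_le_finrank_of_supporting hp0 hpC
    (fun x hx => norm_sq_le_inner_of_infDist_eq (convex_convexHull ℝ _) hpC hp
      (subset_convexHull ℝ _ hx))
  obtain ⟨F, hFS, hFm, hpF⟩ : ∃ F ⊆ S \ K₀, F.card ≤ m ∧ p ∈ convexHull ℝ (y s '' (F : Set ι)) := by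
    have : Nonempty ι := ⟨(hne ∅ (by simp)).choose⟩
    have h : ∀ x ∈ F', ∃ i, i ∈ S \ K₀ ∧ y s i = x := fun x hx => hF'C hx
    choose! g hg using h
    refine ⟨F'.image g, ?_, Finset.card_image_le.trans hF'm, convexHull_mono ?_ hpF'⟩
    · intro i hi
      obtain ⟨x, hx, rfl⟩ := Finset.mem_image.1 hi
      exact (hg x hx).1
    · intro x hx
      exact ⟨g x, by simpa using ⟨x, hx, rfl⟩, (hg x hx).2⟩
  have hFS' : F ⊆ S := hFS.trans Finset.sdiff_subset
  have hT : j * m + 1 ≤ (S \ F).card := by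
    rw [Finset.card_sdiff_of_subset hFS']
    rw [Nat.succ_mul] at hS
    omega
  -- new signs outside `F`, up to a global sign so that many vectors leave the supporting half-space
  obtain ⟨s₁, hs₁, hs₁p⟩ : ∃ s₁ : ι → ℤˣ,
      (∀ K : Finset ι, K.card < j →
        (0 : E) ∈ convexHull ℝ (y s₁ '' (((S \ F) \ K : Finset ι) : Set ι))) ∧
      j + 1 ≤ ((S \ F).filter fun i => inner ℝ p (y s₁ i) ≤ 0).card := by
    obtain ⟨s₁, hs₁⟩ := ih (S \ F) hT
    have hneg : ∀ i, y (-s₁) i = -y s₁ i := fun i => by simp [hy]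
    have hcov : (S \ F).card ≤ ((S \ F).filter fun i => inner ℝ p (y s₁ i) ≤ 0).card +
        ((S \ F).filter fun i => inner ℝ p (y (-s₁) i) ≤ 0).card := by
      refine le_trans (Finset.card_le_card ?_) (Finset.card_union_le _ _)
      intro i hi
      rw [Finset.mem_union, Finset.mem_filter, Finset.mem_filter, hneg, inner_neg_right,
        neg_nonpos]
      exact (le_total (inner ℝ p (y s₁ i)) 0).imp (fun h => ⟨hi, h⟩) (fun h => ⟨hi, h⟩)
    have h2j : j * 2 ≤ j * m := Nat.mul_le_mul_left j hE
    by_cases h : j + 1 ≤ ((S \ F).filter fun i => inner ℝ p (y s₁ i) ≤ 0).card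
    · exact ⟨s₁, hs₁, h⟩
    · refine ⟨-s₁, fun K hK => ?_, by omega⟩
      have h1 : y (-s₁) '' (((S \ F) \ K : Finset ι) : Set ι) =
          -(y s₁ '' (((S \ F) \ K : Finset ι) : Set ι)) := by
        rw [← Set.image_neg_eq_neg, Set.image_image]
        simp only [hneg]
      rw [h1, convexHull_neg, Set.mem_neg, neg_zero]
      exact hs₁ K hK
  let s₂ : ι → ℤˣ := fun i => if i ∈ F then s i else s₁ i
  have hs₂F : ∀ i ∈ F, y s₂ i = y s i := fun i hi => by simp [hy, s₂, hi]
  have hs₂T : ∀ i ∉ F, y s₂ i = y s₁ i := fun i hi => by simp [hy, s₂, hi]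
  have hlt : ∀ K : Finset ι, K.card < j + 1 → Metric.infDist 0 (C s₂ K) < ‖p‖ := by
    intro K hK
    by_cases hKF : Disjoint K F
    · obtain ⟨i, hi, hiK⟩ := Finset.exists_mem_notMem_of_card_lt_card (lt_of_lt_of_le hK hs₁p)
      simp only [Finset.mem_filter, Finset.mem_sdiff] at hi
      have hpK : p ∈ C s₂ K := by
        refine convexHull_mono ?_ hpF
        rintro _ ⟨l, hl, rfl⟩
        refine ⟨l, ?_, hs₂F l hl⟩
        have := Finset.disjoint_right.1 hKF hl
        simpa using ⟨hFS' hl, this⟩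
      have hiC : y s₂ i ∈ C s₂ K :=
        subset_convexHull ℝ _ ⟨i, by simpa using ⟨hi.1.1, hiK⟩, rfl⟩
      refine lt_of_le_of_ne ?_ fun h => ?_
      · simpa using Metric.infDist_le_dist_of_mem (x := (0 : E)) hpK
      · have h1 := norm_sq_le_inner_of_infDist_eq (convex_convexHull ℝ _) hpK h hiC
        rw [hs₂T i hi.1.2] at h1
        exact hp0 (norm_eq_zero.1 (pow_eq_zero_iff two_ne_zero |>.1
          (le_antisymm (h1.trans hi.2) (sq_nonneg _))))
    · have hK' : (K \ F).card < j := by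
        obtain ⟨l, hlK, hlF⟩ := Finset.not_disjoint_iff.1 hKF
        have : (K \ F).card < K.card := Finset.card_lt_card
          ⟨Finset.sdiff_subset, fun h => (Finset.mem_sdiff.1 (h hlK)).2 hlF⟩
        omega
      have h0 : (0 : E) ∈ C s₂ K := by
        refine convexHull_mono ?_ (hs₁ (K \ F) hK')
        rintro _ ⟨l, hl, rfl⟩
        simp only [Finset.coe_sdiff, Set.mem_sdiff, Finset.mem_coe, not_and, not_not] at hl
        refine ⟨l, ?_, hs₂T l hl.1.2⟩
        simpa using ⟨hl.1.1, fun h => hl.1.2 (hl.2 h)⟩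
      rw [Metric.infDist_zero_of_mem h0]
      exact norm_pos_iff.2 hp0
  have h1 := hs s₂
  rw [hK₀, hp] at h1
  exact absurd h1 (not_le.2 ((Finset.sup'_lt_iff hP).2 fun K hK => hlt K (by simpa [P] using hK)))

/-- Radon's theorem with tolerance `k`: the signs of `exists_tolerant_signs` for the lifted points
`(x, 1)` are a `k`-divisible partition. -/
theorem isDivisible_of_le_card {d k : ℕ} (hd : 1 ≤ d) {X : Finset (EuclideanSpace ℝ (Fin d))}
    (hX : (k + 1) * (d + 1) + 1 ≤ X.card) : IsDivisible k X := by
  classical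
  let E := WithLp 2 (EuclideanSpace ℝ (Fin d) × ℝ)
  have hE : Module.finrank ℝ E = d + 1 := by
    rw [LinearEquiv.finrank_eq (WithLp.linearEquiv 2 ℝ (EuclideanSpace ℝ (Fin d) × ℝ))]
    simp
  let v : X → E := fun x => WithLp.toLp 2 (x.1, 1)
  obtain ⟨s, hs⟩ := exists_tolerant_signs (by omega : 2 ≤ Module.finrank ℝ E) v (k + 1)
    Finset.univ (by rw [hE]; simpa using hX)
  refine ⟨{x | ∃ h : x ∈ X, s ⟨x, h⟩ = 1}, {x | ∃ h : x ∈ X, s ⟨x, h⟩ = -1}, ?_, ?_, ?_⟩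
  · ext x
    constructor
    · rintro (⟨h, -⟩ | ⟨h, -⟩) <;> exact h
    · intro h
      exact (Int.units_eq_one_or (s ⟨x, h⟩)).imp (fun h1 => ⟨h, h1⟩) (fun h1 => ⟨h, h1⟩)
  · ext x
    simp only [Set.mem_inter_iff, Set.mem_ofPred_eq, Set.mem_empty_iff_false, iff_false]
    rintro ⟨⟨h, h1⟩, ⟨h', h2⟩⟩
    rw [h1] at h2
    exact absurd h2 (by decide)
  · intro K hKX hKk
    have h0 := hs (Finset.univ.filter fun x : X => x.1 ∈ K) (by
      refine Nat.lt_succ_of_le (le_trans ?_ hKk)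
      exact Finset.card_le_card_of_injOn (fun x => x.1) (by intro x hx; simpa using hx)
        Subtype.val_injective.injOn)
    rw [convexHull_eq] at h0
    obtain ⟨κ, t, w, z, hw0, hw1, hz, hc⟩ := h0
    have hX0 : Nonempty X := by
      rw [nonempty_subtype]
      exact Finset.card_pos.1 (by omega)
    choose! g hg hgz using hz
    rw [Finset.centerMass_eq_of_sum_1 _ _ hw1] at hc
    have hgK : ∀ i ∈ t, (g i).1 ∉ K := fun i hi => by simpa using hg i hi
    have hc' : ∑ i ∈ t, (w i * ((s (g i) : ℤ) : ℝ)) • v (g i) = 0 := by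
      rw [← hc]
      exact Finset.sum_congr rfl fun i hi => by rw [mul_smul, ← hgz i hi]
    have hc1 : ∑ i ∈ t, (w i * ((s (g i) : ℤ) : ℝ)) • (g i).1 = 0 := by
      have := congrArg (fun e => (WithLp.linearEquiv 2 ℝ (EuclideanSpace ℝ (Fin d) × ℝ) e).1) hc'
      simpa [v, map_sum, Prod.fst_sum] using this
    have hc2 : ∑ i ∈ t, w i * ((s (g i) : ℤ) : ℝ) = 0 := by
      have := congrArg (fun e => (WithLp.linearEquiv 2 ℝ (EuclideanSpace ℝ (Fin d) × ℝ) e).2) hc'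
      simpa [v, map_sum, Prod.snd_sum] using this
    have hs2 : ∀ i ∈ t.filter (fun i => ¬ s (g i) = 1), s (g i) = -1 := fun i hi =>
      (Int.units_eq_one_or (s (g i))).resolve_left (Finset.mem_filter.1 hi).2
    have e1 : ∑ i ∈ t.filter (fun i => s (g i) = 1), (w i * ((s (g i) : ℤ) : ℝ)) • (g i).1 =
        ∑ i ∈ t.filter (fun i => s (g i) = 1), w i • (g i).1 :=
      Finset.sum_congr rfl fun i hi => by simp [(Finset.mem_filter.1 hi).2]
    have e2 : ∑ i ∈ t.filter (fun i => ¬ s (g i) = 1), (w i * ((s (g i) : ℤ) : ℝ)) • (g i).1 =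
        -∑ i ∈ t.filter (fun i => ¬ s (g i) = 1), w i • (g i).1 := by
      rw [← Finset.sum_neg_distrib]
      exact Finset.sum_congr rfl fun i hi => by simp [hs2 i hi]
    have e3 : ∑ i ∈ t.filter (fun i => s (g i) = 1), w i * ((s (g i) : ℤ) : ℝ) =
        ∑ i ∈ t.filter (fun i => s (g i) = 1), w i :=
      Finset.sum_congr rfl fun i hi => by simp [(Finset.mem_filter.1 hi).2]
    have e4 : ∑ i ∈ t.filter (fun i => ¬ s (g i) = 1), w i * ((s (g i) : ℤ) : ℝ) =
        -∑ i ∈ t.filter (fun i => ¬ s (g i) = 1), w i := by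
      rw [← Finset.sum_neg_distrib]
      exact Finset.sum_congr rfl fun i hi => by simp [hs2 i hi]
    rw [← Finset.sum_filter_add_sum_filter_not t (fun i => s (g i) = 1), e1, e2,
      add_neg_eq_zero] at hc1
    rw [← Finset.sum_filter_add_sum_filter_not t (fun i => s (g i) = 1), e3, e4,
      add_neg_eq_zero] at hc2
    rw [← Finset.sum_filter_add_sum_filter_not t (fun i => s (g i) = 1)] at hw1
    refine ⟨(t.filter fun i => s (g i) = 1).centerMass w fun i => (g i).1, ?_, ?_⟩
    · refine Finset.centerMass_mem_convexHull _ (fun i hi => hw0 i (Finset.mem_filter.1 hi).1)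
        (by linarith) fun i hi => ⟨⟨(g i).2, (Finset.mem_filter.1 hi).2⟩, ?_⟩
      exact hgK i (Finset.mem_filter.1 hi).1
    · rw [Finset.centerMass, hc1, hc2, ← Finset.centerMass]
      refine Finset.centerMass_mem_convexHull _ (fun i hi => hw0 i (Finset.mem_filter.1 hi).1)
        (by linarith) fun i hi => ⟨⟨(g i).2, hs2 i hi⟩, ?_⟩
      exact hgK i (Finset.mem_filter.1 hi).1

/-! ### Sign patterns along staircases -/

/-- One step `± 1` of a walk on `ℤ`: it goes in the direction of the sign `σ` from a positive height,
and against it otherwise. -/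
def stepHeight (h : ℤ) (σ : ℤˣ) : ℤ := if 0 < h then h + (σ : ℤ) else h - (σ : ℤ)

/-- The height in column `j` of the walk that starts at height one and is driven by the changes of
sign `s j * s (j + 1)` of the sequence `s`. -/
def height (s : ℕ → ℤˣ) : ℕ → ℤ
  | 0 => 1
  | j + 1 => stepHeight (height s j) (s j * s (j + 1))

theorem height_congr {s s' : ℕ → ℤˣ} {j : ℕ} (h : ∀ l ≤ j, s l = s' l) :
    height s j = height s' j := by
  induction j with
  | zero => rfl
  | succ j ih =>
    rw [height, height, ih fun l hl => h l (by omega), h j (by omega), h (j + 1) le_rfl]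

/-- `Reaches s j e δ f`: changing at most `e` of the signs `s 0, …, s j` leads to height `f` in
column `j`, where `δ` tells whether the sign in column `j` itself has been changed. -/
def Reaches (s : ℕ → ℤˣ) (j e : ℕ) (δ : ℤˣ) (f : ℤ) : Prop :=
  ∃ s' : ℕ → ℤˣ, ((Finset.range (j + 1)).filter fun l => s l ≠ s' l).card ≤ e ∧
    s' j = δ * s j ∧ height s' j = f

theorem reaches_self (s : ℕ → ℤˣ) (j : ℕ) : Reaches s j 0 1 (height s j) :=
  ⟨s, by simp, by simp, rfl⟩

theorem Reaches.step {s : ℕ → ℤˣ} {j e : ℕ} {δ : ℤˣ} {f : ℤ} (h : Reaches s j e δ f) (δ' : ℤˣ)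
    {e' : ℕ} (he : e + (if δ' = 1 then 0 else 1) ≤ e') :
    Reaches s (j + 1) e' δ' (stepHeight f (δ * δ' * (s j * s (j + 1)))) := by
  obtain ⟨s', h1, h2, h3⟩ := h
  have hs' : ∀ l ≤ j, Function.update s' (j + 1) (δ' * s (j + 1)) l = s' l := fun l hl =>
    Function.update_of_ne (by omega) _ _
  refine ⟨Function.update s' (j + 1) (δ' * s (j + 1)), ?_, by simp, ?_⟩
  · refine le_trans ?_ he
    rw [Finset.card_filter, Finset.sum_range_succ, Function.update_self]
    refine add_le_add (le_of_eq_of_le ?_ h1) ?_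
    · rw [Finset.card_filter]
      refine Finset.sum_congr rfl fun l hl => ?_
      rw [hs' l (by simpa [Nat.lt_succ_iff] using hl)]
    · rcases Int.units_eq_one_or δ' with rfl | rfl <;> simp
  · rw [height, height_congr hs', h3, hs' j le_rfl, h2, Function.update_self]
    congr 1
    rw [mul_mul_mul_comm]

/-- The invariant along the walk. Whenever its height is at least two, some walk with two changes of
sign is at a height at most zero, and moves opposite to the original one as long as that does not
come back to height one. When it does come back, the two walks may merge; a walk with only one
change is therefore kept in reserve, and spends its second change at that visit. -/
theorem reaches_invariant (s : ℕ → ℤˣ) (j : ℕ) :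
    (height s j = 1 → ∃ δ f, Reaches s j 2 δ f ∧ (f ≤ -1 ∨ (δ = -1 ∧ f = 1))) ∧
    (2 ≤ height s j → (∃ f, Reaches s j 2 1 f ∧ f ≤ 2 - height s j) ∧
      ((∃ f, Reaches s j 1 1 f ∧ (f = height s j - 2 ∨ f ≤ 2 - height s j)) ∨
        (height s j = 2 ∧ Reaches s j 1 (-1) 0))) := by
  induction j with
  | zero =>
    refine ⟨fun _ => ⟨-1, 1, ⟨fun l => -s l, ?_, by simp, rfl⟩, by simp⟩, fun h => ?_⟩
    · exact (Finset.card_filter_le _ _).trans (by simp)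
    · simp [height] at h
  | succ j ih =>
    obtain ⟨ih1, ih2⟩ := ih
    have hself := reaches_self s j
    set h := height s j with hh
    have hstep : height s (j + 1) = stepHeight h (s j * s (j + 1)) := rfl
    rw [hstep]
    have key : ∀ {e δ f} (_ : Reaches s j e δ f) (δ' : ℤˣ) (e' : ℕ)
      (_ : e + (if δ' = 1 then 0 else 1) ≤ e') (g : ℤ)
      (_ : stepHeight f (δ * δ' * (s j * s (j + 1))) = g), Reaches s (j + 1) e' δ' g := by
      intro e δ f hr δ' e' he g hg
      exact hg ▸ hr.step δ' he
    generalize s j * s (j + 1) = σ at *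
    refine ⟨fun h1 => ?_, fun h2 => ?_⟩
    · by_cases hpos : 0 < h
      · -- the walk comes down from height two
        have : σ = -1 ∧ h = 2 := by
          rcases Int.units_eq_one_or σ with rfl | rfl <;> simp [stepHeight, hpos] at h1 ⊢ <;> omega
        obtain ⟨rfl, h2⟩ := this
        obtain ⟨-, ⟨f, hf, hf'⟩ | ⟨-, hf⟩⟩ := ih2 h2.ge
        · refine ⟨-1, f - 1, key hf (-1) 2 (by simp) _ ?_, Or.inl (by omega)⟩
          have : ¬ 0 < f := by omega
          simp [stepHeight, this]
        · exact ⟨1, -1, key hf 1 2 (by simp) _ (by simp [stepHeight]), Or.inl le_rfl⟩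
      · -- the walk comes up from height zero
        have : σ = -1 ∧ h = 0 := by
          rcases Int.units_eq_one_or σ with rfl | rfl <;> simp [stepHeight, hpos] at h1 ⊢ <;> omega
        obtain ⟨rfl, h2⟩ := this
        refine ⟨-1, -1, key hself (-1) 2 (by simp) _ ?_, Or.inl le_rfl⟩
        simp [stepHeight, h2]
    · have hpos : 0 < h := by
        by_contra hpos
        rcases Int.units_eq_one_or σ with rfl | rfl <;> simp [stepHeight, hpos] at h2 <;> omega
      by_cases h1 : h = 1
      · obtain ⟨δ, f, hf, hf'⟩ := ih1 h1
        have : σ = 1 := by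
          rcases Int.units_eq_one_or σ with rfl | rfl
          · rfl
          · simp [stepHeight, h1] at h2
        subst this
        rw [h1]
        refine ⟨?_, Or.inr ⟨by simp [stepHeight], key hself (-1) 1 (by simp) _ ?_⟩⟩
        · refine ⟨_, key hf 1 2 (by simp) _ rfl, ?_⟩
          rcases hf' with hf' | ⟨rfl, rfl⟩
          · have : ¬ 0 < f := by omega
            rcases Int.units_eq_one_or δ with rfl | rfl <;> simp [stepHeight, this] <;> omega
          · simp [stepHeight]
        · simp [stepHeight, h1]
      · have h3 : 2 ≤ h := by omega
        obtain ⟨⟨f, hf, hf'⟩, hJ⟩ := ih2 h3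
        have hf0 : ¬ 0 < f := by omega
        have hσ : stepHeight h σ = h + (σ : ℤ) := by simp [stepHeight, hpos]
        rw [hσ] at h2 ⊢
        refine ⟨⟨f - (σ : ℤ), key hf 1 2 (by simp) _ (by simp [stepHeight, hf0]), by omega⟩, ?_⟩
        left
        obtain ⟨g, hg, hg'⟩ | ⟨h4, hg⟩ := hJ
        · by_cases hg0 : 0 < g
          · exact ⟨g + (σ : ℤ), key hg 1 1 (by simp) _ (by simp [stepHeight, hg0]), by omega⟩
          · exact ⟨g - (σ : ℤ), key hg 1 1 (by simp) _ (by simp [stepHeight, hg0]), by omega⟩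
        · have : σ = 1 := by
            rcases Int.units_eq_one_or σ with rfl | rfl
            · rfl
            · simp [h4] at h2
          subst this
          exact ⟨1, key hg 1 1 (by simp) _ (by simp [stepHeight]), by simp [h4]⟩

/-- The row in column `j` of the greedy staircase: it keeps its row as long as the signs `s` agree
there with the row of `a` up to a common sign, and moves on to the next row otherwise. -/
def greedyRow (a : ℕ → ℕ → ℤˣ) (s : ℕ → ℤˣ) : ℕ → ℕ
  | 0 => 0
  | j + 1 => if s j * s (j + 1) = a (greedyRow a s j) j * a (greedyRow a s j) (j + 1)
      then greedyRow a s j else greedyRow a s j + 1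

theorem greedyRow_monotone (a : ℕ → ℕ → ℤˣ) (s : ℕ → ℤˣ) : Monotone (greedyRow a s) := by
  refine monotone_nat_of_le_succ fun j => ?_
  rw [greedyRow]
  split_ifs <;> omega

/-- Along the greedy staircase the signs `s` are those of `a`, up to one sign for each row. -/
theorem exists_rowSigns (a : ℕ → ℕ → ℤˣ) (s : ℕ → ℤˣ) (j : ℕ) :
    ∃ ε : ℕ → ℤˣ, ∀ l ≤ j, s l = ε (greedyRow a s l) * a (greedyRow a s l) l := by
  induction j with
  | zero =>
    refine ⟨fun _ => s 0 * a 0 0, fun l hl => ?_⟩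
    obtain rfl : l = 0 := by omega
    simp [greedyRow, mul_assoc]
  | succ j ih =>
    obtain ⟨ε, hε⟩ := ih
    by_cases h : s j * s (j + 1) = a (greedyRow a s j) j * a (greedyRow a s j) (j + 1)
    · refine ⟨ε, fun l hl => ?_⟩
      rcases Nat.le_succ_iff.1 hl with hl | rfl
      · exact hε l hl
      · have h1 : greedyRow a s (j + 1) = greedyRow a s j := by rw [greedyRow, if_pos h]
        rw [Nat.succ_eq_add_one, h1]
        rw [hε j le_rfl, mul_comm (ε _), mul_assoc] at h
        rw [← mul_left_cancel h, ← mul_assoc, Int.units_mul_self, one_mul]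
    · have h1 : greedyRow a s (j + 1) = greedyRow a s j + 1 := by rw [greedyRow, if_neg h]
      refine ⟨Function.update ε (greedyRow a s (j + 1))
        (s (j + 1) * a (greedyRow a s (j + 1)) (j + 1)), fun l hl => ?_⟩
      rcases Nat.le_succ_iff.1 hl with hl | rfl
      · have := greedyRow_monotone a s hl
        rw [Function.update_of_ne (by omega)]
        exact hε l hl
      · simp [mul_assoc]

/-- The sign matrix of the construction: row `i` alternates in the columns `j ≤ 2 * i` and is
constant in the columns `j > 2 * i`. -/
def diagonalSign (i j : ℕ) : ℤˣ := if j ≤ 2 * i then (-1) ^ (j + 1) else 1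

theorem diagonalSign_mul_succ (i j : ℕ) :
    diagonalSign i j * diagonalSign i (j + 1) = if j ≤ 2 * i then -1 else 1 := by
  unfold diagonalSign
  by_cases h : j + 1 ≤ 2 * i
  · rw [if_pos h, if_pos (by omega), if_pos (by omega), pow_succ _ (j + 1), ← mul_assoc,
      Int.units_mul_self, one_mul]
  · by_cases h' : j ≤ 2 * i
    · obtain rfl : j = 2 * i := by omega
      simp [pow_succ, pow_mul]
    · simp [h, h']

/-- For `diagonalSign`, the row of the greedy staircase, measured from the diagonal, performs the
walk `height`: the sign of the height tells whether the current row alternates or is constant. -/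
theorem height_eq_greedyRow (s : ℕ → ℤˣ) (j : ℕ) :
    height s j = 2 * (greedyRow diagonalSign s j : ℤ) - j + 1 := by
  induction j with
  | zero => simp [height, greedyRow]
  | succ j ih =>
    rw [height, greedyRow, diagonalSign_mul_succ, ih, stepHeight]
    generalize greedyRow diagonalSign s j = i
    by_cases h : j ≤ 2 * i
    · rw [if_pos (by omega), if_pos h]
      rcases Int.units_eq_one_or (s j * s (j + 1)) with h1 | h1 <;> rw [h1] <;> simp <;> ring
    · rw [if_neg (by omega), if_neg h]
      rcases Int.units_eq_one_or (s j * s (j + 1)) with h1 | h1 <;> rw [h1] <;> simp <;> ring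

theorem exists_majority : ∀ x y z : ℤˣ, ∃ η : ℤˣ,
    (if x ≠ η then 1 else 0) + (if y ≠ η then 1 else 0) + (if z ≠ η then 1 else 0) ≤ 1 := by
  decide

/-- With `m + q` rows, every pattern of `2 * m + 3 * q` signs is realized along a monotone staircase
with at most `q + 2` errors: the walk handles the first `2 * m` columns with two errors, and each
further row covers three columns with one error, by majority. -/
theorem exists_staircase {m : ℕ} (hm : 1 ≤ m) (q : ℕ) (s : ℕ → ℤˣ) :
    ∃ (p : ℕ → ℕ) (ε : ℕ → ℤˣ), Monotone p ∧ (∀ j < 2 * m + 3 * q, p j < m + q) ∧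
      ((Finset.range (2 * m + 3 * q)).filter fun j =>
        s j ≠ ε (p j) * diagonalSign (p j) j).card ≤ q + 2 := by
  induction q with
  | zero =>
    obtain ⟨n, hn⟩ : ∃ n, 2 * m = n + 1 := ⟨2 * m - 1, by omega⟩
    obtain ⟨s', hs', hh⟩ : ∃ s' : ℕ → ℤˣ,
        ((Finset.range (n + 1)).filter fun l => s l ≠ s' l).card ≤ 2 ∧ height s' n ≤ 0 := by
      have hpar := height_eq_greedyRow s n
      rcases le_or_gt (height s n) 0 with h | h
      · exact ⟨s, by simp, h⟩
      · -- the height is even in the odd column `n`, hence at least two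
        obtain ⟨⟨f, ⟨s', h1, -, h2⟩, h3⟩, -⟩ := (reaches_invariant s n).2 (by omega)
        exact ⟨s', h1, by omega⟩
    obtain ⟨ε, hε⟩ := exists_rowSigns diagonalSign s' n
    rw [height_eq_greedyRow] at hh
    refine ⟨greedyRow diagonalSign s', ε, greedyRow_monotone _ _, fun j hj => ?_, ?_⟩
    · have := greedyRow_monotone diagonalSign s' (show j ≤ n by omega)
      omega
    · rw [mul_zero, add_zero, hn, zero_add]
      refine le_trans (Finset.card_le_card fun l hl => ?_) hs'
      rw [Finset.mem_filter] at hl ⊢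
      rw [hε l (by have := Finset.mem_range.1 hl.1; omega)]
      exact hl
  | succ q ih =>
    obtain ⟨p, ε, hp, hpm, he⟩ := ih
    set N := 2 * m + 3 * q with hN
    obtain ⟨η, hη⟩ := exists_majority (s N * diagonalSign (m + q) N)
      (s (N + 1) * diagonalSign (m + q) (N + 1)) (s (N + 2) * diagonalSign (m + q) (N + 2))
    have hne : ∀ j, s j * diagonalSign (m + q) j ≠ η ↔ s j ≠ η * diagonalSign (m + q) j := by
      intro j
      rw [not_iff_not, ← mul_inv_eq_iff_eq_mul, Int.units_inv_eq_self]
    rw [if_congr (hne N) rfl rfl, if_congr (hne _) rfl rfl, if_congr (hne _) rfl rfl] at hη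
    refine ⟨fun j => if j < N then p j else m + q, Function.update ε (m + q) η, ?_, ?_, ?_⟩
    · intro j l hjl
      by_cases hl : l < N
      · simpa [hl, lt_of_le_of_lt hjl hl] using hp hjl
      · by_cases hj : j < N
        · simpa [hl, hj] using (hpm j hj).le
        · simp [hl, hj]
    · intro j hj
      by_cases h : j < N
      · have := hpm j h
        simp only [h, if_true]
        omega
      · simp only [h, if_false]
        omega
    · have hN3 : 2 * m + 3 * (q + 1) = N + 1 + 1 + 1 := by omega
      rw [hN3, Finset.card_filter, Finset.sum_range_succ, Finset.sum_range_succ,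
        Finset.sum_range_succ]
      have h1 : (∑ j ∈ Finset.range N, if s j ≠ Function.update ε (m + q) η
          (if j < N then p j else m + q) * diagonalSign (if j < N then p j else m + q) j
          then 1 else 0) ≤ q + 2 := by
        refine le_of_eq_of_le ?_ he
        rw [Finset.card_filter]
        refine Finset.sum_congr rfl fun j hj => ?_
        have hj' := Finset.mem_range.1 hj
        have := hpm j hj'
        rw [if_pos hj', Function.update_of_ne (by omega)]
      have e1 : ¬ N + 1 < N := by omega
      have e2 : ¬ N + 2 < N := by omega
      simp only [lt_irrefl, e1, e2, if_false, Function.update_self, add_assoc]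
        at h1 hη ⊢
      omega

/-! ### Staircases and linear functionals -/

/-- A sum of terms `± B ^ φ i` has the sign of its largest term if the largest exponent is attained
only once and `B` exceeds the number of terms. -/
theorem sign_mul_sum_zpow_pos {M : ℕ} {B : ℝ} (hB : (M : ℝ) < B) (c : ℕ → ℤˣ) (φ : ℕ → ℤ)
    {i₀ : ℕ} (hi₀ : i₀ < M) (hφ : ∀ i < M, i ≠ i₀ → φ i ≤ φ i₀ - 1) :
    0 < ((c i₀ : ℤ) : ℝ) * ∑ i ∈ Finset.range M, ((c i : ℤ) : ℝ) * B ^ φ i := by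
  have hM : (1 : ℝ) ≤ M := by exact_mod_cast Nat.one_le_of_lt hi₀
  have hB0 : 0 < B := by linarith
  have habs : ∀ i, |((c i : ℤ) : ℝ)| = 1 := fun i => by
    rcases Int.units_eq_one_or (c i) with h | h <;> simp [h]
  have hsq : ((c i₀ : ℤ) : ℝ) * ((c i₀ : ℤ) : ℝ) = 1 := by
    rcases Int.units_eq_one_or (c i₀) with h | h <;> simp [h]
  have hrest : |((c i₀ : ℤ) : ℝ) * ∑ i ∈ (Finset.range M).erase i₀, ((c i : ℤ) : ℝ) * B ^ φ i| ≤
      M * B ^ (φ i₀ - 1) := by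
    rw [abs_mul, habs, one_mul]
    refine (Finset.abs_sum_le_sum_abs _ _).trans ?_
    have hle : ∀ i ∈ (Finset.range M).erase i₀,
        |((c i : ℤ) : ℝ) * B ^ φ i| ≤ B ^ (φ i₀ - 1) := by
      intro i hi
      rw [Finset.mem_erase, Finset.mem_range] at hi
      rw [abs_mul, habs, one_mul, abs_of_pos (zpow_pos hB0 _)]
      exact zpow_le_zpow_right₀ (by linarith) (hφ i hi.2 hi.1)
    refine (Finset.sum_le_card_nsmul _ _ _ hle).trans ?_
    rw [nsmul_eq_mul]
    gcongr
    simpa using Finset.card_erase_le (s := Finset.range M) (a := i₀)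
  have hmain : (M : ℝ) * B ^ (φ i₀ - 1) < B ^ φ i₀ := by
    have h1 : B ^ φ i₀ = B * B ^ (φ i₀ - 1) := by
      rw [← zpow_one_add₀ hB0.ne']
      congr 1
      ring
    rw [h1]
    exact mul_lt_mul_of_pos_right hB (zpow_pos hB0 _)
  rw [← Finset.add_sum_erase _ _ (Finset.mem_range.2 hi₀), mul_add, ← mul_assoc, hsq, one_mul]
  linarith [(abs_le.1 hrest).1]

/-- The sign patterns along monotone staircases are realized by linear combinations of the rows
`i ↦ (a i j * B ^ (2 * i * j))_j`: the coefficients can be chosen so that the term of row `p j`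
dominates in column `j`. -/
theorem exists_coeff_of_monotone {M : ℕ} {B : ℝ} (hB : (M : ℝ) < B) (a : ℕ → ℕ → ℤˣ) {p : ℕ → ℕ}
    (hp : Monotone p) (ε : ℕ → ℤˣ) {N : ℕ} (hpM : ∀ j < N, p j < M) :
    ∃ u : ℕ → ℝ, ∀ j < N, 0 < (((ε (p j) * a (p j) j : ℤˣ) : ℤ) : ℝ) *
      ∑ i ∈ Finset.range M, u i * (((a i j : ℤ) : ℝ) * B ^ (2 * i * j)) := by
  -- `b l` is the column in which the staircase leaves the rows up to `l`
  have hb : ∀ l, ∃ b : ℕ, ∀ j < N, (j < b ↔ p j ≤ l) := by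
    intro l
    by_cases h : ∃ j, l < p j
    · refine ⟨Nat.find h, fun j _ => ⟨fun hj => not_lt.1 (Nat.find_min h hj), fun hj => ?_⟩⟩
      by_contra hlt
      have := hp (not_lt.1 hlt)
      have := Nat.find_spec h
      omega
    · exact ⟨N, fun j hj => ⟨fun _ => not_lt.1 fun h' => h ⟨j, h'⟩, fun _ => hj⟩⟩
  choose b hb using hb
  refine ⟨fun i => ((ε i : ℤ) : ℝ) * B ^ (-∑ l ∈ Finset.range i, (2 * (b l : ℤ) - 1)),
    fun j hj => ?_⟩
  have hB0 : 0 < B := lt_of_le_of_lt (Nat.cast_nonneg M) hB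
  let φ : ℕ → ℤ := fun i => 2 * i * j - ∑ l ∈ Finset.range i, (2 * (b l : ℤ) - 1)
  have hφ : ∀ i, φ (i + 1) = φ i + (2 * ((j : ℤ) - b i) + 1) := by
    intro i
    simp only [φ, Finset.sum_range_succ]
    push_cast
    ring
  have hup : ∀ n i, i + n ≤ p j → φ i + n ≤ φ (i + n) := by
    intro n
    induction n with
    | zero => intro i _; simp
    | succ n ih =>
      intro i hi
      have h1 := ih i (by omega)
      have h2 := hφ (i + n)
      have h3 := hb (i + n) j hj
      rw [← add_assoc i n 1, h2]
      push_cast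
      omega
  have hdown : ∀ n, φ (p j + n) + n ≤ φ (p j) := by
    intro n
    induction n with
    | zero => simp
    | succ n ih =>
      have h2 := hφ (p j + n)
      have h3 := hb (p j + n) j hj
      rw [← add_assoc (p j) n 1, h2]
      push_cast
      omega
  have hpos := sign_mul_sum_zpow_pos hB (fun i => ε i * a i j) φ (hpM j hj) (by
    intro i _ hi
    rcases lt_or_gt_of_ne hi with h | h
    · obtain ⟨n, hn⟩ := Nat.exists_eq_add_of_lt h
      have := hup (n + 1) i (by omega)
      rw [show i + (n + 1) = p j by omega] at this
      push_cast at this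
      omega
    · obtain ⟨n, hn⟩ := Nat.exists_eq_add_of_lt h
      have := hdown (n + 1)
      rw [show p j + (n + 1) = i by omega] at this
      push_cast at this
      omega)
  convert hpos using 2
  refine Finset.sum_congr rfl fun i _ => ?_
  have : B ^ φ i = B ^ (-∑ l ∈ Finset.range i, (2 * (b l : ℤ) - 1)) * B ^ (2 * i * j) := by
    rw [← zpow_natCast, ← zpow_add₀ hB0.ne']
    congr 1
    simp only [φ]
    push_cast
    ring
  rw [this]
  push_cast
  ring

/-! ### The points of the lower bound -/

/-- The points of the lower bound: the columns of the matrix `diagonalSign i j * B ^ (2 * i * j)`,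
dehomogenized by the entry of row `0`. -/
noncomputable def diagonalPoint (d j : ℕ) : EuclideanSpace ℝ (Fin d) :=
  WithLp.toLp 2 fun i => ((diagonalSign 0 j : ℤ) : ℝ) *
    (((diagonalSign (i + 1) j : ℤ) : ℝ) * ((d : ℝ) + 2) ^ (2 * ((i : ℕ) + 1) * j))

theorem diagonalPoint_injective {d : ℕ} (hd : 1 ≤ d) : Function.Injective (diagonalPoint d) := by
  have habs : ∀ x : ℤˣ, |((x : ℤ) : ℝ)| = 1 := fun x => by
    rcases Int.units_eq_one_or x with h | h <;> simp [h]
  intro j l h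
  have h1 := congrArg (fun x : EuclideanSpace ℝ (Fin d) => |x ⟨0, hd⟩|) h
  have h0 : (0 : ℝ) ≤ d := Nat.cast_nonneg d
  simp only [diagonalPoint, abs_mul, habs, one_mul, abs_pow] at h1
  rw [abs_of_pos (by linarith)] at h1
  have := pow_right_injective₀ (by linarith : (0 : ℝ) < (d : ℝ) + 2) (by linarith) h1
  simpa using this

/-- An affine function at `diagonalPoint d j` is, up to the sign of row `0`, a linear combination of
the entries of column `j` of the matrix. -/
theorem affine_diagonalPoint (d j : ℕ) (u : ℕ → ℝ) :
    u 0 + ∑ i : Fin d, u (i + 1) * diagonalPoint d j i = ((diagonalSign 0 j : ℤ) : ℝ) *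
      ∑ i ∈ Finset.range (d + 1),
        u i * (((diagonalSign i j : ℤ) : ℝ) * ((d : ℝ) + 2) ^ (2 * i * j)) := by
  have hsq : ((diagonalSign 0 j : ℤ) : ℝ) * ((diagonalSign 0 j : ℤ) : ℝ) = 1 := by
    rcases Int.units_eq_one_or (diagonalSign 0 j) with h | h <;> simp [h]
  rw [Finset.sum_range_succ', ← Fin.sum_univ_eq_sum_range
    (fun i => u (i + 1) * (((diagonalSign (i + 1) j : ℤ) : ℝ) *
      ((d : ℝ) + 2) ^ (2 * (i + 1) * j))), mul_add, Finset.mul_sum, add_comm]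
  congr 1
  · refine Finset.sum_congr rfl fun i _ => ?_
    simp only [diagonalPoint]
    ring
  · simp only [mul_zero, zero_mul, pow_zero, mul_one]
    rw [mul_left_comm, hsq, mul_one]

/-- The first `n ≤ 2 * d + k` points `diagonalPoint d j` are not `k`-divisible: the signs of any
partition are realized, up to at most `k` errors, by an affine function. -/
theorem not_isDivisible_diagonalPoint {d k n : ℕ} (hk : 2 ≤ k) (hkd : k ≤ d + 2)
    (hn : n ≤ 2 * d + k) :
    ¬ IsDivisible k ((Finset.range n).image (diagonalPoint d)) := by
  classical
  rintro ⟨A, A', hU, hI, h⟩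
  let s : ℕ → ℤˣ := fun j => diagonalSign 0 j * if diagonalPoint d j ∈ A then 1 else -1
  obtain ⟨p, ε, hp, hpM, he⟩ := exists_staircase (show 1 ≤ d + 3 - k by omega) (k - 2) s
  have hN : 2 * (d + 3 - k) + 3 * (k - 2) = 2 * d + k := by omega
  have hM : d + 3 - k + (k - 2) = d + 1 := by omega
  rw [hN] at hpM he
  rw [hM] at hpM
  rw [Nat.sub_add_cancel hk] at he
  obtain ⟨u, hu⟩ := exists_coeff_of_monotone (B := (d : ℝ) + 2) (M := d + 1)
    (by push_cast; linarith) diagonalSign hp ε hpM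
  -- remove the points where the affine function given by `u` has the wrong sign
  set K := ((Finset.range n).filter fun j =>
    s j ≠ ε (p j) * diagonalSign (p j) j).image (diagonalPoint d) with hK
  have hKX : K ⊆ (Finset.range n).image (diagonalPoint d) :=
    Finset.image_subset_image (Finset.filter_subset _ _)
  have hKk : K.card ≤ k :=
    Finset.card_image_le.trans ((Finset.card_le_card
      (Finset.filter_subset_filter _ (Finset.range_subset_range.2 hn))).trans he)
  let L : EuclideanSpace ℝ (Fin d) → ℝ := fun x => ∑ i : Fin d, u (i + 1) * x i
  have hL : IsLinearMap ℝ L :=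
    { map_add := fun x y => by simp [L, mul_add, Finset.sum_add_distrib]
      map_smul := fun c x => by simp [L, Finset.mul_sum, mul_left_comm] }
  have hsep : ∀ x ∈ (A ∪ A') \ (K : Set (EuclideanSpace ℝ (Fin d))),
      0 < (((if x ∈ A then 1 else -1 : ℤˣ) : ℤ) : ℝ) * (u 0 + L x) := by
    rintro x ⟨hx, hxK⟩
    rw [hU, Finset.mem_coe, Finset.mem_image] at hx
    obtain ⟨j, hj, rfl⟩ := hx
    have hjs : s j = ε (p j) * diagonalSign (p j) j := by
      by_contra hne
      exact hxK (Finset.mem_image_of_mem _ (Finset.mem_filter.2 ⟨hj, hne⟩))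
    have h1 := hu j ((Finset.mem_range.1 hj).trans_le hn)
    rw [← hjs] at h1
    rw [affine_diagonalPoint]
    convert h1 using 1
    simp only [s]
    push_cast
    ring
  obtain ⟨z, hzA, hzA'⟩ := h K hKX hKk
  have h1 : z ∈ {x | -u 0 < L x} := by
    refine convexHull_min ?_ (convex_halfSpace_gt hL _) hzA
    rintro x ⟨hxA, hxK⟩
    have := hsep x ⟨Or.inl hxA, hxK⟩
    rw [if_pos hxA] at this
    simp only [Units.val_one, Int.cast_one, one_mul] at this
    show -u 0 < L x
    linarith
  have h2 : z ∈ {x | L x < -u 0} := by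
    refine convexHull_min ?_ (convex_halfSpace_lt hL _) hzA'
    rintro x ⟨hxA', hxK⟩
    have hxA : x ∉ A := fun hxA => (hI ▸ (⟨hxA, hxA'⟩ : x ∈ A ∩ A') : x ∈ (∅ : Set _))
    have := hsep x ⟨Or.inr hxA', hxK⟩
    rw [if_neg hxA] at this
    simp only [Units.val_neg, Units.val_one, Int.cast_neg, Int.cast_one, neg_mul, one_mul] at this
    show L x < -u 0
    linarith
  exact lt_asymm (show -u 0 < L z from h1) h2

/-! ### Bounds for the divisibility number -/

theorem theorem2 (d k : ℕ) (hk : 2 ≤ k) (hkd : k ≤ d / 2) :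
    IsLeast (divisibleCards d k) (divisibilityNumber d k) ∧
      2 * d + k + 1 ≤ divisibilityNumber d k ∧
      divisibilityNumber d k ≤ (k + 1) * d + (k + 2) := by
  have hmem : (k + 1) * d + (k + 2) ∈ divisibleCards d k := fun X hX =>
    isDivisible_of_le_card (by omega) (by rw [hX]; exact le_of_eq (by ring))
  have hleast : divisibilityNumber d k ∈ divisibleCards d k := Nat.sInf_mem ⟨_, hmem⟩
  refine ⟨⟨hleast, fun n hn => Nat.sInf_le hn⟩, ?_, Nat.sInf_le hmem⟩
  by_contra hlt
  refine not_isDivisible_diagonalPoint hk (by omega) (by omega : divisibilityNumber d k ≤ 2 * d + k)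
    (hleast _ ?_)
  rw [Finset.card_image_of_injective _ (diagonalPoint_injective (by omega)), Finset.card_range]
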